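/- Let $B_n$ denote the $n$-th Bernoulli number and $\zeta(s)=\sum_{n\ge 1} n^{-s}$ the Riemann zeta function. For an integer $k\ge 2$ let $$P_k(z):=\frac{(2\pi)^{2k-1}}{(2k)!}\sum_{j=0}^{k}(-1)^j B_{2j}B_{2k-2j}\binom{2k}{2j}z^{2j}+\zeta(2k-1)\left(z^{2k-1}+(-1)^k z\right).$$ Suppose that $2\le k<1000$. Then all of the complex zeros of $P_k(z)$ lie on the unit circle $|z|=1$. Furthermore, all of the zeros are simple. -/

import Mathlib

open Polynomial

/-- The polynomial
`P_k(z) = (2π)^(2k-1) / (2k)! * ∑_{j=0}^{k} (-1)^j B_{2j} B_{2k-2j} (2k choose 2j) z^(2j)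
  + ζ(2k-1) (z^(2k-1) + (-1)^k z)`
with complex coefficients (meant for `2 ≤ k`). -/
noncomputable def ramanujanP (k : ℕ) : ℂ[X] :=
  C ((2 * (Real.pi : ℂ)) ^ (2 * k - 1) / ((2 * k).factorial : ℂ)) *
      ∑ j ∈ Finset.range (k + 1),
        C ((-1 : ℂ) ^ j * (_root_.bernoulli (2 * j) : ℂ) * (_root_.bernoulli (2 * k - 2 * j) : ℂ) *
          ((2 * k).choose (2 * j) : ℂ)) * X ^ (2 * j) +
    C (riemannZeta (2 * (k : ℂ) - 1)) * (X ^ (2 * k - 1) + C ((-1 : ℂ) ^ k) * X)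

/-! Exhibit 2k distinct zeros on the unit circle; the degree is at most 2k, so these are all the
zeros and each is simple. Write L(z) for the Lambert series `lambertCoth k z`. On the open right
half circle, Ramanujan's formula (`lambertCoth_functional_equation`) gives P_k(z) = -(z^(2k-1)
L(1/z) + (-1)^k z L(z)). At -z the even part is unchanged and the odd part changes sign, so L is
replaced by 2ζ(2k-1) + L. Either way P_k has the form z^(2k-1) U(1/z) + (-1)^k z U(z) up to sign. As
1/z is the conjugate of z and U commutes with conjugation, it vanishes at z = e^(iθ), where U = R
e^(-iψ), as soon as (k-1)θ + ψ(θ) ≡ (k-1)π/2 mod π; the intermediate value theorem supplies such θ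
(`exists_finset_zeros_of_phase`). Right half: L is close to its first term 2/(e^(2πz) - 1)
(`norm_lambertCoth_mul_sub_one_le`), whose phase 2π sin θ forces k + 2 zeros. Left half: U has
positive real part (`two_zeta_add_lambertCoth_re_pos`), so ψ stays within π/2 of 0 and k - 2 zeros
remain. -/

/-! ### Bernoulli numbers as zeta values. -/

/-- Euler's formula solved for the Bernoulli number. It includes j = 0, where ζ(0) = -1/2, so the
end terms of P_k need no separate treatment. -/
lemma bernoulli_two_mul_eq_riemannZeta (j : ℕ) :
    (_root_.bernoulli (2 * j) : ℂ) =
      (-1) ^ (j + 1) * 2 * (2 * j).factorial * riemannZeta (2 * j) /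
        (2 * (Real.pi : ℂ)) ^ (2 * j) := by
  have hpi : (Real.pi : ℂ) ≠ 0 := by exact_mod_cast Real.pi_ne_zero
  have hf : ((2 * j).factorial : ℂ) ≠ 0 := by exact_mod_cast (2 * j).factorial_ne_zero
  have h2 : (2 : ℂ) ^ (2 * j - 1 : ℤ) = 2 ^ (2 * j) / 2 := by
    rw [zpow_sub₀ two_ne_zero, zpow_one]; norm_cast
  have hs : ((-1 : ℂ) ^ (j + 1)) * (-1) ^ (j + 1) = 1 := by
    rw [← mul_pow]; simp
  rw [riemannZeta_two_mul_nat', h2, mul_pow]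
  field_simp
  linear_combination (-(_root_.bernoulli (2 * j) : ℂ)) * hs

lemma eval_ramanujanP {k : ℕ} (hk : 1 ≤ k) (z : ℂ) :
    (ramanujanP k).eval z =
      2 / Real.pi * (-1) ^ k * ∑ j ∈ Finset.range (k + 1),
        (-1) ^ j * riemannZeta (2 * (j : ℕ)) * riemannZeta (2 * ((k - j : ℕ) : ℂ)) * z ^ (2 * j) +
      riemannZeta (2 * (k : ℂ) - 1) * (z ^ (2 * k - 1) + (-1) ^ k * z) := by
  have hpi : (Real.pi : ℂ) ≠ 0 := by exact_mod_cast Real.pi_ne_zero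
  have hf (n : ℕ) : (n.factorial : ℂ) ≠ 0 := by exact_mod_cast n.factorial_ne_zero
  simp only [ramanujanP, eval_add, eval_mul, eval_C, eval_pow, eval_X, eval_finsetSum]
  congr 1
  rw [Finset.mul_sum, Finset.mul_sum]
  refine Finset.sum_congr rfl fun j hj => ?_
  obtain ⟨i, rfl⟩ : ∃ i, k = j + i := ⟨k - j, by have := Finset.mem_range.1 hj; omega⟩
  rw [show 2 * (j + i) - 2 * j = 2 * i by omega, show j + i - j = i by omega,
    bernoulli_two_mul_eq_riemannZeta, bernoulli_two_mul_eq_riemannZeta,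
    show 2 * (j + i) = 2 * j + 2 * i by ring, Nat.cast_add_choose,
    pow_sub₀ _ (by simp [hpi]) (by omega)]
  have h1 := hf (2 * j)
  have h2 := hf (2 * i)
  have h3 := hf (2 * j + 2 * i)
  field_simp
  ring

lemma hasSum_riemannZeta_nat {s : ℕ} (hs : 2 ≤ s) :
    HasSum (fun n : ℕ => 1 / ((n : ℂ) + 1) ^ s) (riemannZeta s) := by
  have hsum : Summable fun n : ℕ => 1 / ((n : ℂ) + 1) ^ s := by
    have := (summable_nat_add_iff 1).2 (Real.summable_one_div_nat_pow.2 (by omega : 1 < s))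
    refine Summable.of_norm (this.congr fun n => ?_)
    rw [norm_div, norm_pow, norm_one]
    norm_cast
  convert hsum.hasSum using 1
  rw [zeta_eq_tsum_one_div_nat_add_one_cpow (by simp; omega)]
  simp

/-! ### Partial fractions of the hyperbolic cotangent. -/

lemma mem_integerComplement_I_mul {w : ℂ} (hw : 0 < w.re) :
    Complex.I * w ∈ Complex.integerComplement := by
  rintro ⟨n, hn⟩
  have := congrArg Complex.im hn
  simp at this
  linarith

lemma sq_add_sq_ne_zero_of_re_pos {w : ℂ} (hw : 0 < w.re) (x : ℝ) : w ^ 2 + (x : ℂ) ^ 2 ≠ 0 := by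
  intro h
  have : (w + Complex.I * x) * (w - Complex.I * x) = 0 := by
    ring_nf; simp only [Complex.I_sq]; linear_combination h
  rcases mul_eq_zero.1 this with h | h <;>
  · have := congrArg Complex.re h
    simp at this
    linarith

lemma exp_sub_one_ne_zero_of_re_pos {w : ℂ} (hw : 0 < w.re) : Complex.exp w - 1 ≠ 0 := by
  intro h
  have h1 : ‖Complex.exp w‖ = 1 := by rw [sub_eq_zero.1 h]; simp
  rw [Complex.norm_exp, Real.exp_eq_one_iff] at h1
  linarith

lemma two_pi_mul_re_pos {w : ℂ} (hw : 0 < w.re) : 0 < (2 * Real.pi * w).re := by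
  simpa using by positivity

/-- The partial fraction series of cot at iw; the bracket on the right is coth(πw). -/
lemma tsum_inv_sq_add_sq {w : ℂ} (hw : 0 < w.re) :
    ∑' m : ℕ, 2 * w / (w ^ 2 + ((m : ℂ) + 1) ^ 2) =
      Real.pi * (1 + 2 / (Complex.exp (2 * Real.pi * w) - 1)) - 1 / w := by
  have hw0 : w ≠ 0 := by rintro rfl; simp at hw
  have hpi : (Real.pi : ℂ) ≠ 0 := by exact_mod_cast Real.pi_ne_zero
  have hq : Complex.exp (2 * Real.pi * w) - 1 ≠ 0 :=
    exp_sub_one_ne_zero_of_re_pos (two_pi_mul_re_pos hw)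
  have key := cot_series_rep' (mem_integerComplement_I_mul hw)
  have h1 : ∀ m : ℕ, 2 * w / (w ^ 2 + ((m : ℂ) + 1) ^ 2) =
      Complex.I * (1 / (Complex.I * w - (m + 1)) + 1 / (Complex.I * w + (m + 1))) := by
    intro m
    have h0 := sq_add_sq_ne_zero_of_re_pos hw (m + 1)
    push_cast at h0
    have hp : (Complex.I * w - (m + 1)) * (Complex.I * w + (m + 1)) = -(w ^ 2 + (m + 1) ^ 2) := by
      ring_nf; simp only [Complex.I_sq]; ring
    have hne : (Complex.I * w - (m + 1)) * (Complex.I * w + (m + 1)) ≠ 0 := by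
      rw [hp]; exact neg_ne_zero.2 h0
    rw [one_div_add_one_div (left_ne_zero_of_mul hne) (right_ne_zero_of_mul hne), hp]
    field_simp
    ring_nf
    simp only [Complex.I_sq]
    ring
  rw [tsum_congr h1, tsum_mul_left, ← key, Complex.cot_pi_eq_exp_ratio,
    show 2 * Real.pi * Complex.I * (Complex.I * w) = -(2 * Real.pi * w) by
      ring_nf; simp only [Complex.I_sq]; ring, Complex.exp_neg]
  set q := Complex.exp (2 * Real.pi * w) with hqd
  have hq0 : q ≠ 0 := Complex.exp_ne_zero _
  have h3 : 1 - q⁻¹ ≠ 0 := by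
    intro h
    apply hq
    have : q⁻¹ = 1 := by linear_combination -h
    rw [inv_eq_one.1 this]; ring
  have hI : Complex.I ≠ 0 := Complex.I_ne_zero
  rw [show 1 - q⁻¹ = (q - 1) / q by field_simp]
  field_simp
  ring

/-! ### Ramanujan's formula on the right half circle. -/

/-- The Lambert series `∑_{n ≥ 1} 2 / (n^(2k-1) (e^(2πnz) - 1))`. -/
noncomputable def lambertCoth (k : ℕ) (z : ℂ) : ℂ :=
  ∑' n : ℕ, 1 / ((n : ℂ) + 1) ^ (2 * k - 1) *
    (2 / (Complex.exp (2 * Real.pi * (((n : ℂ) + 1) * z)) - 1))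

/-- The summand `1 / (n^(2k-2) (n² z² + m²))` of a double series over `n, m ≥ 1`. -/
noncomputable def doubleTerm (k : ℕ) (z : ℂ) (p : ℕ × ℕ) : ℂ :=
  1 / (((p.1 : ℂ) + 1) ^ (2 * k - 2) *
    ((((p.1 : ℂ) + 1) * z) ^ 2 + ((p.2 : ℂ) + 1) ^ 2))

lemma re_natCast_add_one_mul (n : ℕ) (z : ℂ) : (((n : ℂ) + 1) * z).re = (n + 1) * z.re := by
  simp

lemma re_natCast_add_one_mul_pos (n : ℕ) {z : ℂ} (hz : 0 < z.re) :
    0 < (((n : ℂ) + 1) * z).re := by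
  rw [re_natCast_add_one_mul]; positivity

lemma summable_one_div_succ_pow {s : ℕ} (hs : 2 ≤ s) :
    Summable fun n : ℕ => 1 / ((n : ℝ) + 1) ^ s := by
  simpa using (summable_nat_add_iff 1).2 (Real.summable_one_div_nat_pow.2 (by omega : 1 < s))

lemma norm_natCast_add_one (n : ℕ) : ‖(n : ℂ) + 1‖ = n + 1 := by
  norm_cast

lemma norm_lambertCoth_term_le (k n : ℕ) {z : ℂ} {x : ℝ} (hx : 0 < x) (hz : x ≤ z.re) :
    ‖1 / ((n : ℂ) + 1) ^ (2 * k - 1) *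
      (2 / (Complex.exp (2 * Real.pi * (((n : ℂ) + 1) * z)) - 1))‖ ≤
    1 / ((n : ℝ) + 1) ^ (2 * k - 1) * (2 / (Real.exp (2 * Real.pi * x) - 1)) := by
  have h1 : 0 < Real.exp (2 * Real.pi * x) - 1 := by
    have := Real.add_one_lt_exp (x := 2 * Real.pi * x) (by positivity)
    have : 0 < 2 * Real.pi * x := by positivity
    linarith
  rw [norm_mul, norm_div, norm_div, norm_pow, norm_natCast_add_one, norm_one,
    Complex.norm_ofNat]
  gcongr
  calc Real.exp (2 * Real.pi * x) - 1
      ≤ ‖Complex.exp (2 * Real.pi * (((n : ℂ) + 1) * z))‖ - ‖(1 : ℂ)‖ := by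
        rw [Complex.norm_exp, norm_one]
        gcongr
        simp only [Complex.mul_re, Complex.re_ofNat, Complex.ofReal_re, Complex.im_ofNat,
          Complex.ofReal_im]
        simp
        have : 0 ≤ (n : ℝ) * z.re := by have := hx.le.trans hz; positivity
        gcongr
        nlinarith
    _ ≤ _ := norm_sub_norm_le _ _

lemma summable_lambertCoth {k : ℕ} (hk : 2 ≤ k) {z : ℂ} (hz : 0 < z.re) :
    Summable fun n : ℕ => 1 / ((n : ℂ) + 1) ^ (2 * k - 1) *
      (2 / (Complex.exp (2 * Real.pi * (((n : ℂ) + 1) * z)) - 1)) :=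
  Summable.of_norm_bounded ((summable_one_div_succ_pow (by omega)).mul_right _)
    fun n => norm_lambertCoth_term_le k n hz le_rfl

/-- On the unit circle a z² + b = z (a z + b z̄), and the second factor has real part (a + b) Re z.
This keeps the denominators of the double series away from 0. -/
lemma le_norm_mul_sq_add {z : ℂ} (hz1 : ‖z‖ = 1) (a b : ℝ) :
    (a + b) * z.re ≤ ‖(a : ℂ) * z ^ 2 + b‖ := by
  have hz0 : z ≠ 0 := by rintro rfl; simp at hz1
  have h : (a : ℂ) * z ^ 2 + b = z * (a * z + b * (starRingEnd ℂ) z) := by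
    have : z * (starRingEnd ℂ) z = 1 := by rw [Complex.mul_conj']; simp [hz1]
    linear_combination (-(b : ℂ)) * this
  rw [h, norm_mul, hz1, one_mul]
  refine le_trans (le_of_eq ?_) (Complex.re_le_norm _)
  simp
  ring

lemma summable_doubleTerm {k : ℕ} (hk : 2 ≤ k) {z : ℂ} (hz : 0 < z.re) (hz1 : ‖z‖ = 1) :
    Summable (doubleTerm k z) := by
  have h2 := summable_one_div_succ_pow (le_refl 2)
  refine Summable.of_norm_bounded ((h2.mul_of_nonneg h2 (fun n => by positivity)
    (fun n => by positivity)).mul_right (1 / z.re)) fun p => ?_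
  obtain ⟨n, m⟩ := p
  rw [doubleTerm, norm_div, norm_one, norm_mul, norm_pow, norm_natCast_add_one, mul_pow]
  have h3 := le_norm_mul_sq_add hz1 (((n : ℝ) + 1) ^ 2) (((m : ℝ) + 1) ^ 2)
  push_cast at h3
  dsimp only
  rw [one_div_mul_one_div, one_div_mul_one_div]
  apply one_div_le_one_div_of_le (by positivity)
  rw [mul_assoc]
  have hn : (1 : ℝ) ≤ n + 1 := by linarith [n.cast_nonneg (α := ℝ)]
  refine mul_le_mul (pow_le_pow_right₀ hn (by omega)) (le_trans ?_ h3) (by positivity)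
    (by positivity)
  nlinarith [sq_nonneg ((n : ℝ) + 1)]

/-- The left side is z ∑ coth(πnz) / n^(2k-1); expand each coth in partial fractions. The polar
terms 1/(nz) add up to the multiple of ζ(2k). -/
lemma mul_zeta_add_lambertCoth {k : ℕ} (hk : 2 ≤ k) {z : ℂ} (hz : 0 < z.re) (hz1 : ‖z‖ = 1) :
    z * (riemannZeta (2 * (k : ℂ) - 1) + lambertCoth k z) =
      riemannZeta (2 * (k : ℂ)) / Real.pi + 2 * z ^ 2 / Real.pi * ∑' p, doubleTerm k z p := by
  have hz0 : z ≠ 0 := by rintro rfl; simp at hz1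
  have hpi : (Real.pi : ℂ) ≠ 0 := by exact_mod_cast Real.pi_ne_zero
  have hT := (summable_lambertCoth hk hz).hasSum
  have hA := hasSum_riemannZeta_nat (s := 2 * k - 1) (by omega)
  have hB := hasSum_riemannZeta_nat (s := 2 * k) (by omega)
  rw [show ((2 * k - 1 : ℕ) : ℂ) = 2 * (k : ℂ) - 1 by
    rw [Nat.cast_sub (by omega)]; push_cast; ring] at hA
  rw [show ((2 * k : ℕ) : ℂ) = 2 * (k : ℂ) by push_cast; ring] at hB
  have hD := (summable_doubleTerm hk hz hz1).tsum_prod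
  have key := ((hA.add hT).mul_left z).sub (hB.mul_left (1 / (Real.pi : ℂ)))
  have hterm : ∀ n : ℕ, 2 * z ^ 2 / Real.pi * ∑' m, doubleTerm k z (n, m) =
      z * (1 / ((n : ℂ) + 1) ^ (2 * k - 1) + 1 / ((n : ℂ) + 1) ^ (2 * k - 1) *
        (2 / (Complex.exp (2 * Real.pi * (((n : ℂ) + 1) * z)) - 1))) -
      1 / (Real.pi : ℂ) * (1 / ((n : ℂ) + 1) ^ (2 * k)) := by
    intro n
    have hn : (n : ℂ) + 1 ≠ 0 := by exact_mod_cast n.succ_ne_zero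
    have hw := re_natCast_add_one_mul_pos n hz
    have h1 := tsum_inv_sq_add_sq hw
    have h2 : ∑' m, doubleTerm k z (n, m) =
        1 / (((n : ℂ) + 1) ^ (2 * k - 2) * (2 * (((n : ℂ) + 1) * z))) *
          ∑' m : ℕ, 2 * (((n : ℂ) + 1) * z) / ((((n : ℂ) + 1) * z) ^ 2 + ((m : ℂ) + 1) ^ 2) := by
      rw [← tsum_mul_left]
      refine tsum_congr fun m => ?_
      have h0 := sq_add_sq_ne_zero_of_re_pos hw (m + 1)
      push_cast at h0
      rw [doubleTerm]
      field_simp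
    rw [h2, h1]
    have hq := exp_sub_one_ne_zero_of_re_pos (two_pi_mul_re_pos hw)
    obtain ⟨l, rfl⟩ : ∃ l, k = l + 1 := ⟨k - 1, by omega⟩
    rw [show 2 * (l + 1) - 2 = 2 * l by omega, show 2 * (l + 1) - 1 = 2 * l + 1 by omega,
      show 2 * (l + 1) = 2 * l + 2 by ring]
    generalize Complex.exp (2 * Real.pi * (((n : ℂ) + 1) * z)) - 1 = Q at hq
    field_simp
    ring
  rw [hD, ← tsum_mul_left, tsum_congr hterm, key.tsum_eq, lambertCoth]
  ring

/-- With the indices swapped at 1/z, both terms have the denominator (Nz)² + M² up to monomials,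
where N = n + 1 and M = m + 1. It divides the combined numerator, by the geometric sum for y^l -
(-x)^l with x = z²/M², y = 1/N², l = k - 1. The quotient separates n from m and so sums to products
of zeta values. -/
lemma doubleTerm_add_doubleTerm_inv {k : ℕ} (hk : 2 ≤ k) {z : ℂ} (hz : 0 < z.re) (n m : ℕ) :
    z ^ (2 * k - 2) * doubleTerm k z⁻¹ (m, n) + (-1) ^ k * z ^ 2 * doubleTerm k z (n, m) =
      ∑ i ∈ Finset.range (k - 1), (-1) ^ k * (-1) ^ i * z ^ (2 * (i + 1)) *
        (1 / ((n : ℂ) + 1) ^ (2 * (k - (i + 1))) * (1 / ((m : ℂ) + 1) ^ (2 * (i + 1)))) := by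
  have hz0 : z ≠ 0 := by rintro rfl; simp at hz
  have hn : (n : ℂ) + 1 ≠ 0 := by exact_mod_cast n.succ_ne_zero
  have hm : (m : ℂ) + 1 ≠ 0 := by exact_mod_cast m.succ_ne_zero
  have h0 := sq_add_sq_ne_zero_of_re_pos (re_natCast_add_one_mul_pos n hz) (m + 1)
  push_cast at h0
  simp only [doubleTerm]
  generalize (n : ℂ) + 1 = N at *
  generalize (m : ℂ) + 1 = M at *
  obtain ⟨l, rfl⟩ : ∃ l, k = l + 1 := ⟨k - 1, by omega⟩
  rw [show 2 * (l + 1) - 2 = 2 * l by omega, Nat.add_sub_cancel]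
  set x : ℂ := z ^ 2 / M ^ 2 with hx
  set y : ℂ := 1 / N ^ 2 with hy
  have hxy : x + y ≠ 0 := by
    have : x + y = ((N * z) ^ 2 + M ^ 2) / (M ^ 2 * N ^ 2) := by rw [hx, hy]; field_simp
    rw [this]
    exact div_ne_zero h0 (by positivity)
  have hg := (Commute.all (-x) y).geom_sum₂_mul l
  have hs : ∑ i ∈ Finset.range l, (-1) ^ (l + 1) * (-1) ^ i * z ^ (2 * (i + 1)) *
        (1 / N ^ (2 * (l + 1 - (i + 1))) * (1 / M ^ (2 * (i + 1)))) =
      (-1) ^ (l + 1) * (x * y) * ∑ i ∈ Finset.range l, (-x) ^ i * y ^ (l - 1 - i) := by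
    rw [Finset.mul_sum]
    refine Finset.sum_congr rfl fun i hi => ?_
    obtain ⟨r, rfl⟩ : ∃ r, l = i + 1 + r := ⟨l - 1 - i, by have := Finset.mem_range.1 hi; omega⟩
    rw [show i + 1 + r + 1 - (i + 1) = r + 1 by omega, show i + 1 + r - 1 - i = r by omega, hx, hy,
      neg_pow (z ^ 2 / M ^ 2) i, div_pow, div_pow, one_pow, ← pow_mul, ← pow_mul, ← pow_mul]
    field_simp
    ring
  have hd1 : 1 / (M ^ (2 * l) * ((M * z⁻¹) ^ 2 + N ^ 2)) * z ^ (2 * l) = x ^ l * (x * y) / (x + y) := by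
    rw [hx, hy, div_pow, ← pow_mul, ← pow_mul]
    have : (M * z⁻¹) ^ 2 + N ^ 2 = ((N * z) ^ 2 + M ^ 2) / z ^ 2 := by field_simp; ring
    rw [this]
    have : z ^ 2 / M ^ 2 + 1 / N ^ 2 = ((N * z) ^ 2 + M ^ 2) / (M ^ 2 * N ^ 2) := by field_simp
    rw [this]
    field_simp
  have hd2 : z ^ 2 * (1 / (N ^ (2 * l) * ((N * z) ^ 2 + M ^ 2))) = y ^ l * (x * y) / (x + y) := by
    have : x + y = ((N * z) ^ 2 + M ^ 2) / (M ^ 2 * N ^ 2) := by rw [hx, hy]; field_simp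
    rw [this, hx, hy, div_pow, one_pow, ← pow_mul]
    field_simp
  rw [hs, mul_comm (z ^ (2 * l)), hd1, mul_assoc ((-1) ^ (l + 1)), hd2]
  have h4 : ∑ i ∈ Finset.range l, (-x) ^ i * y ^ (l - 1 - i) = (y ^ l - (-x) ^ l) / (x + y) := by
    rw [eq_div_iff hxy]; linear_combination -hg
  have h5 : (-1 : ℂ) ^ (l + 1) * (-x) ^ l = - x ^ l := by
    rw [neg_pow, pow_succ]
    have : (-1 : ℂ) ^ l * (-1) ^ l = 1 := by rw [← mul_pow]; simp
    linear_combination (- x ^ l) * this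
  rw [h4]
  linear_combination (x * y / (x + y)) * h5

lemma hasSum_riemannZeta_mul_riemannZeta {s t : ℕ} (hs : 2 ≤ s) (ht : 2 ≤ t) :
    HasSum (fun p : ℕ × ℕ => 1 / ((p.1 : ℂ) + 1) ^ s * (1 / ((p.2 : ℂ) + 1) ^ t))
      (riemannZeta s * riemannZeta t) := by
  have ha := hasSum_riemannZeta_nat hs
  have hb := hasSum_riemannZeta_nat ht
  have h := summable_mul_of_summable_norm ha.summable.norm hb.summable.norm
  rw [← ha.tsum_eq, ← hb.tsum_eq, ha.summable.tsum_mul_tsum hb.summable h]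
  exact h.hasSum

lemma lambertCoth_functional_equation {k : ℕ} (hk : 2 ≤ k) {z : ℂ} (hz : 0 < z.re)
    (hz1 : ‖z‖ = 1) :
    z ^ (2 * k - 1) * (riemannZeta (2 * (k : ℂ) - 1) + lambertCoth k z⁻¹) +
      (-1) ^ k * z * (riemannZeta (2 * (k : ℂ) - 1) + lambertCoth k z) =
    -(2 / Real.pi * (-1) ^ k * ∑ j ∈ Finset.range (k + 1),
        (-1) ^ j * riemannZeta (2 * (j : ℕ)) * riemannZeta (2 * ((k - j : ℕ) : ℂ)) *
          z ^ (2 * j)) := by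
  have hz0 : z ≠ 0 := by rintro rfl; simp at hz1
  have hpi : (Real.pi : ℂ) ≠ 0 := by exact_mod_cast Real.pi_ne_zero
  have hzi : 0 < (z⁻¹).re := by
    rw [Complex.inv_re, Complex.normSq_eq_norm_sq, hz1]; simpa using hz
  have hzi1 : ‖z⁻¹‖ = 1 := by rw [norm_inv, hz1, inv_one]
  have h1 := mul_zeta_add_lambertCoth hk hz hz1
  have h2 := mul_zeta_add_lambertCoth hk hzi hzi1
  have hs1 := (summable_doubleTerm hk hz hz1).hasSum
  -- Absolute convergence permits exchanging n and m in the series at 1/z, which pairs the two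
  -- series term by term.
  have hs2 := ((Equiv.prodComm ℕ ℕ).hasSum_iff.2 (summable_doubleTerm hk hzi hzi1).hasSum)
  have hs := (hs2.mul_left (z ^ (2 * k - 2))).add (hs1.mul_left ((-1) ^ k * z ^ 2))
  have hr : HasSum (fun p : ℕ × ℕ => ∑ i ∈ Finset.range (k - 1),
      (-1) ^ k * (-1) ^ i * z ^ (2 * (i + 1)) *
        (1 / ((p.1 : ℂ) + 1) ^ (2 * (k - (i + 1))) * (1 / ((p.2 : ℂ) + 1) ^ (2 * (i + 1)))))
      (∑ i ∈ Finset.range (k - 1), (-1) ^ k * (-1) ^ i * z ^ (2 * (i + 1)) *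
        (riemannZeta ((2 * (k - (i + 1)) : ℕ) : ℂ) * riemannZeta ((2 * (i + 1) : ℕ) : ℂ))) := by
    refine hasSum_sum fun i hi => HasSum.mul_left _ ?_
    have hi := Finset.mem_range.1 hi
    exact hasSum_riemannZeta_mul_riemannZeta (by omega) (by omega)
  have hu := hs.unique (hr.congr_fun fun p => doubleTerm_add_doubleTerm_inv hk hz p.1 p.2)
  -- The end terms j = 0 and j = k carry ζ(0) = -1/2 and match the ζ(2k) terms coming from the poles
  -- of coth.
  have hsum : ∑ j ∈ Finset.range (k + 1), (-1) ^ j * riemannZeta (2 * (j : ℕ)) *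
        riemannZeta (2 * ((k - j : ℕ) : ℂ)) * z ^ (2 * j) =
      -(1 / 2) * riemannZeta (2 * k) * (1 + (-1) ^ k * z ^ (2 * k)) -
        (-1) ^ k * ∑ i ∈ Finset.range (k - 1), (-1) ^ k * (-1) ^ i * z ^ (2 * (i + 1)) *
          (riemannZeta ((2 * (k - (i + 1)) : ℕ) : ℂ) * riemannZeta ((2 * (i + 1) : ℕ) : ℂ)) := by
    obtain ⟨l, rfl⟩ : ∃ l, k = l + 1 := ⟨k - 1, by omega⟩
    have hone : ((-1 : ℂ) ^ (l + 1)) * (-1) ^ (l + 1) = 1 := by rw [← mul_pow]; simp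
    rw [Finset.sum_range_succ, Finset.sum_range_succ', Nat.add_sub_cancel, Finset.mul_sum,
      sub_eq_add_neg, ← Finset.sum_neg_distrib]
    have hin : ∀ i ∈ Finset.range l, (-1) ^ (i + 1) * riemannZeta (2 * ((i + 1 : ℕ) : ℂ)) *
          riemannZeta (2 * ((l + 1 - (i + 1) : ℕ) : ℂ)) * z ^ (2 * (i + 1)) =
        -((-1) ^ (l + 1) * ((-1) ^ (l + 1) * (-1) ^ i * z ^ (2 * (i + 1)) *
          (riemannZeta ((2 * (l + 1 - (i + 1)) : ℕ) : ℂ) *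
            riemannZeta ((2 * (i + 1) : ℕ) : ℂ)))) := by
      intro i _
      rw [Nat.cast_mul 2 (l + 1 - (i + 1)), Nat.cast_mul 2 (i + 1), Nat.cast_ofNat]
      linear_combination ((-1) ^ i * z ^ (2 * (i + 1)) *
        riemannZeta (2 * ((l + 1 - (i + 1) : ℕ) : ℂ)) * riemannZeta (2 * ((i + 1 : ℕ) : ℂ))) * hone
    rw [Finset.sum_congr rfl hin]
    simp only [Nat.sub_self, Nat.sub_zero, Nat.cast_zero, mul_zero, riemannZeta_zero, pow_zero]
    ring
  have hone : ((-1 : ℂ) ^ k) * (-1) ^ k = 1 := by rw [← mul_pow]; simp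
  have h2' : z ^ (2 * k - 1) * (riemannZeta (2 * (k : ℂ) - 1) + lambertCoth k z⁻¹) =
      z ^ (2 * k) * (riemannZeta (2 * (k : ℂ)) / Real.pi) +
        2 / Real.pi * (z ^ (2 * k - 2) * ∑' p, doubleTerm k z⁻¹ p) := by
    have e1 : z ^ (2 * k) = z ^ (2 * k - 1) * z := by rw [← pow_succ]; congr 1; omega
    have e2 : z ^ (2 * k - 1) = z ^ (2 * k - 2) * z := by rw [← pow_succ]; congr 1; omega
    have h3 : riemannZeta (2 * (k : ℂ) - 1) + lambertCoth k z⁻¹ =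
        z * (z⁻¹ * (riemannZeta (2 * (k : ℂ) - 1) + lambertCoth k z⁻¹)) := by
      rw [mul_inv_cancel_left₀ hz0]
    rw [h3, h2, e1, e2]
    field_simp
  rw [hsum, h2', mul_assoc, h1]
  linear_combination (2 / (Real.pi : ℂ)) * hu -
    (1 / (Real.pi : ℂ)) * (riemannZeta (2 * (k : ℂ)) * z ^ (2 * k) + 2 * ∑ i ∈ Finset.range (k - 1),
      (-1) ^ k * (-1) ^ i * z ^ (2 * (i + 1)) * (riemannZeta ((2 * (k - (i + 1)) : ℕ) : ℂ) *
        riemannZeta ((2 * (i + 1) : ℕ) : ℂ))) * hone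

lemma eval_ramanujanP_eq_lambertCoth {k : ℕ} (hk : 2 ≤ k) {z : ℂ} (hz : 0 < z.re)
    (hz1 : ‖z‖ = 1) :
    (ramanujanP k).eval z =
      -(z ^ (2 * k - 1) * lambertCoth k z⁻¹ + (-1) ^ k * z * lambertCoth k z) := by
  rw [eval_ramanujanP (by omega)]
  linear_combination lambertCoth_functional_equation hk hz hz1

lemma eval_neg_ramanujanP_eq_lambertCoth {k : ℕ} (hk : 2 ≤ k) {z : ℂ} (hz : 0 < z.re)
    (hz1 : ‖z‖ = 1) :
    (ramanujanP k).eval (-z) =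
      -(z ^ (2 * k - 1) * (2 * riemannZeta (2 * (k : ℂ) - 1) + lambertCoth k z⁻¹) +
        (-1) ^ k * z * (2 * riemannZeta (2 * (k : ℂ) - 1) + lambertCoth k z)) := by
  have hodd : (-z) ^ (2 * k - 1) = -z ^ (2 * k - 1) :=
    Odd.neg_pow ⟨k - 1, by omega⟩ z
  rw [eval_ramanujanP (by omega), hodd]
  simp only [(even_two_mul _).neg_pow]
  linear_combination lambertCoth_functional_equation hk hz hz1

lemma lambertCoth_conj (k : ℕ) (z : ℂ) :
    lambertCoth k ((starRingEnd ℂ) z) = (starRingEnd ℂ) (lambertCoth k z) := by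
  rw [lambertCoth, lambertCoth, Complex.conj_tsum]
  refine tsum_congr fun n => ?_
  simp only [map_mul, map_div₀, map_one, map_pow, map_add, map_sub, map_natCast, map_ofNat,
    ← Complex.exp_conj, Complex.conj_ofReal]

/-! ### The Lambert series is close to its first term. -/

lemma norm_exp_two_pi_mul_sub_one_le {z : ℂ} (hz : 0 < z.re) (hz1 : ‖z‖ = 1) :
    ‖Complex.exp (2 * Real.pi * z) - 1‖ ≤ 2 * (Real.exp (2 * Real.pi * z.re) - 1) := by
  have hsq : z.re ^ 2 + z.im ^ 2 = 1 := by
    have := Complex.sq_norm z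
    rw [hz1, Complex.normSq_apply] at this
    linarith
  -- On the circle Re z + |Im z| ≥ 1, so s = ±1 works; the exponential does not see the shift by
  -- 2πis.
  obtain ⟨s, hs⟩ : ∃ s : ℤ, |z.im - s| ≤ z.re := by
    rcases le_total 0 z.im with h | h
    · refine ⟨1, ?_⟩
      rw [abs_le]; push_cast
      constructor <;> nlinarith
    · refine ⟨-1, ?_⟩
      rw [abs_le]; push_cast
      constructor <;> nlinarith
  set φ : ℝ := 2 * Real.pi * (z.im - s) with hφ
  have hexp : Complex.exp (2 * Real.pi * z) =
      Real.exp (2 * Real.pi * z.re) * Complex.exp (Complex.I * φ) := by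
    have hs1 := Complex.exp_int_mul_two_pi_mul_I s
    have hz2 : (2 * Real.pi * z : ℂ) = ((2 * Real.pi * z.re : ℝ) : ℂ) + Complex.I * φ +
        s * (2 * Real.pi * Complex.I) := by
      conv_lhs => rw [← Complex.re_add_im z]
      rw [hφ]; push_cast; ring
    rw [hz2, Complex.exp_add, hs1, mul_one, Complex.exp_add, Complex.ofReal_exp]
  have hφle : ‖φ‖ ≤ 2 * Real.pi * z.re := by
    rw [hφ, Real.norm_eq_abs, abs_mul, abs_of_pos (by positivity : 0 < 2 * Real.pi)]
    gcongr
  have hr : 2 * Real.pi * z.re + 1 ≤ Real.exp (2 * Real.pi * z.re) := Real.add_one_le_exp _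
  have hr0 : 0 ≤ 2 * Real.pi * z.re := by positivity
  calc ‖Complex.exp (2 * Real.pi * z) - 1‖
      = ‖((Real.exp (2 * Real.pi * z.re) - 1 : ℝ) : ℂ) * Complex.exp (Complex.I * φ) +
          (Complex.exp (Complex.I * φ) - 1)‖ := by
        rw [hexp]; congr 1; push_cast; ring
    _ ≤ ‖((Real.exp (2 * Real.pi * z.re) - 1 : ℝ) : ℂ) * Complex.exp (Complex.I * φ)‖ +
          ‖Complex.exp (Complex.I * φ) - 1‖ := norm_add_le _ _
    _ ≤ (Real.exp (2 * Real.pi * z.re) - 1) + 2 * Real.pi * z.re := by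
        refine add_le_add (le_of_eq ?_) (Real.norm_exp_I_mul_ofReal_sub_one_le.trans hφle)
        rw [norm_mul, mul_comm Complex.I, Complex.norm_exp_ofReal_mul_I, mul_one,
          Complex.norm_real, Real.norm_of_nonneg (by linarith)]
    _ ≤ _ := by linarith

lemma mul_exp_sub_one_le_norm (n : ℕ) (z : ℂ) :
    (n + 1) * (Real.exp (2 * Real.pi * z.re) - 1) ≤
      ‖Complex.exp (2 * Real.pi * (((n : ℂ) + 1) * z)) - 1‖ := by
  have h1 : ‖Complex.exp (2 * Real.pi * (((n : ℂ) + 1) * z))‖ =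
      Real.exp (2 * Real.pi * z.re) ^ (n + 1) := by
    rw [Complex.norm_exp, ← Real.exp_nat_mul]
    congr 1
    simp
    ring
  have h2 := one_add_mul_le_pow (a := Real.exp (2 * Real.pi * z.re) - 1)
    (by linarith [Real.exp_pos (2 * Real.pi * z.re)]) (n + 1)
  have h3 := norm_sub_norm_le (Complex.exp (2 * Real.pi * (((n : ℂ) + 1) * z))) 1
  rw [h1, norm_one] at h3
  push_cast at h2
  rw [add_sub_cancel] at h2
  linarith

lemma norm_lambertCoth_mul_sub_one_le {k : ℕ} (hk : 2 ≤ k) {z : ℂ} (hz : 0 < z.re)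
    (hz1 : ‖z‖ = 1) :
    ‖lambertCoth k z * ((Complex.exp (2 * Real.pi * z) - 1) / 2) - 1‖ ≤ 1 / 5 := by
  have hpos : 0 < Real.exp (2 * Real.pi * z.re) - 1 := by
    have : 2 * Real.pi * z.re + 1 ≤ Real.exp (2 * Real.pi * z.re) := Real.add_one_le_exp _
    have : 0 < 2 * Real.pi * z.re := by positivity
    linarith
  have hq0 : Complex.exp (2 * Real.pi * z) - 1 ≠ 0 :=
    exp_sub_one_ne_zero_of_re_pos (two_pi_mul_re_pos hz)
  have hsum := (summable_lambertCoth hk hz).mul_right ((Complex.exp (2 * Real.pi * z) - 1) / 2)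
  rw [lambertCoth, ← tsum_mul_right, hsum.tsum_eq_zero_add]
  have h0 : 1 / (((0 : ℕ) : ℂ) + 1) ^ (2 * k - 1) *
      (2 / (Complex.exp (2 * Real.pi * ((((0 : ℕ) : ℂ) + 1) * z)) - 1)) *
        ((Complex.exp (2 * Real.pi * z) - 1) / 2) = 1 := by
    simp only [Nat.cast_zero, zero_add, one_mul, one_pow, div_one]
    field_simp
  rw [h0, add_sub_cancel_left]
  -- The coefficient gives at most n^(-3), Bernoulli's inequality for |e^(2πnz) - 1| gives another
  -- 1/n, and the bound on |e^(2πz) - 1| costs the factor 2.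
  have h4 : HasSum (fun n : ℕ => 2 * (1 / ((n : ℝ) + 2) ^ 4)) (2 * (Real.pi ^ 4 / 90 - 1)) := by
    refine HasSum.mul_left _ ?_
    have := (hasSum_nat_add_iff' 2).2 hasSum_zeta_four
    simpa [Finset.sum_range_succ] using this
  refine (tsum_of_norm_bounded h4 fun n => ?_).trans ?_
  · have ha := norm_exp_two_pi_mul_sub_one_le hz hz1
    have hb := mul_exp_sub_one_le_norm (n + 1) z
    rw [norm_mul, norm_mul, norm_div, norm_div, norm_div, norm_pow, norm_natCast_add_one,
      norm_one, Complex.norm_ofNat]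
    have hb' : 0 < ((n + 1 : ℕ) + 1 : ℝ) * (Real.exp (2 * Real.pi * z.re) - 1) := by positivity
    have hk4 : 1 / ((n + 1 : ℕ) + 1 : ℝ) ^ (2 * k - 1) ≤ 1 / ((n + 1 : ℕ) + 1 : ℝ) ^ 3 :=
      one_div_le_one_div_of_le (by positivity) (pow_le_pow_right₀ (by
        push_cast; linarith [n.cast_nonneg (α := ℝ)]) (by omega))
    calc _ ≤ 1 / ((n + 1 : ℕ) + 1 : ℝ) ^ 3 *
          (2 / (((n + 1 : ℕ) + 1 : ℝ) * (Real.exp (2 * Real.pi * z.re) - 1))) *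
            (2 * (Real.exp (2 * Real.pi * z.re) - 1) / 2) := by gcongr
      _ = _ := by
        generalize Real.exp (2 * Real.pi * z.re) - 1 = r at *
        push_cast
        rw [show (n : ℝ) + 1 + 1 = n + 2 by ring]
        field_simp
  · have : Real.pi ^ 4 ≤ 3.15 ^ 4 := by
      gcongr
      exact Real.pi_lt_d2.le
    norm_num at this ⊢
    linarith

lemma re_pos_of_norm_sub_one_le {w : ℂ} (hw : ‖w - 1‖ ≤ 1 / 5) : 4 / 5 ≤ w.re := by
  have := (abs_le.1 ((Complex.abs_re_le_norm (w - 1)).trans hw)).1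
  simp at this
  linarith

lemma abs_arg_le_of_norm_sub_one_le {w : ℂ} (hw : ‖w - 1‖ ≤ 1 / 5) :
    |w.arg| ≤ Real.pi / 6 := by
  have hre := re_pos_of_norm_sub_one_le hw
  have him : |w.im| ≤ 1 / 5 := by
    simpa using (Complex.abs_im_le_norm (w - 1)).trans hw
  have hn : 4 / 5 ≤ ‖w‖ := hre.trans (Complex.re_le_norm w)
  have hn0 : 0 < ‖w‖ := by linarith
  rw [Complex.arg_of_re_nonneg (by linarith), abs_le]
  have h := abs_le.1 him
  have hpi := Real.pi_pos
  constructor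
  · rw [Real.le_arcsin_iff_sin_le' ⟨by linarith, by linarith⟩, Real.sin_neg, Real.sin_pi_div_six,
      le_div_iff₀ hn0]
    linarith
  · rw [Real.arcsin_le_iff_le_sin' ⟨by linarith, by linarith⟩, Real.sin_pi_div_six,
      div_le_iff₀ hn0]
    linarith

/-! ### Zeros from the variation of the phase. -/

lemma exp_mul_I_re_pos {t θ : ℝ} (ht : t < Real.pi / 2) (hθ : θ ∈ Set.Icc (-t) t) :
    0 < (Complex.exp (θ * Complex.I)).re := by
  rw [Complex.exp_ofReal_mul_I_re]
  exact Real.cos_pos_of_mem_Ioo ⟨by linarith [hθ.1], by linarith [hθ.2]⟩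

lemma cos_le_exp_mul_I_re {t θ : ℝ} (ht0 : 0 < t) (ht : t < Real.pi / 2)
    (hθ : θ ∈ Set.Icc (-t) t) : Real.cos t ≤ (Complex.exp (θ * Complex.I)).re := by
  rw [Complex.exp_ofReal_mul_I_re, ← Real.cos_abs θ]
  exact Real.cos_le_cos_of_nonneg_of_le_pi (abs_nonneg _) (by linarith [Real.pi_pos])
    (abs_le.2 ⟨hθ.1, hθ.2⟩)

lemma continuousOn_lambertCoth_circle {k : ℕ} (hk : 2 ≤ k) {t : ℝ} (ht0 : 0 < t)
    (ht : t < Real.pi / 2) :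
    ContinuousOn (fun θ : ℝ => lambertCoth k (Complex.exp (θ * Complex.I))) (Set.Icc (-t) t) := by
  have hc : 0 < Real.cos t := Real.cos_pos_of_mem_Ioo ⟨by linarith, ht⟩
  refine continuousOn_tsum (fun n => ?_)
    ((summable_one_div_succ_pow (s := 2 * k - 1) (by omega)).mul_right
      (2 / (Real.exp (2 * Real.pi * Real.cos t) - 1)))
    fun n θ hθ => norm_lambertCoth_term_le k n hc (cos_le_exp_mul_I_re ht0 ht hθ)
  refine ContinuousOn.mul continuousOn_const (ContinuousOn.div continuousOn_const
    (by fun_prop) fun θ hθ => ?_)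
  exact exp_sub_one_ne_zero_of_re_pos
    (two_pi_mul_re_pos (re_natCast_add_one_mul_pos n (exp_mul_I_re_pos ht hθ)))

lemma ContinuousOn.complex_arg {f : ℝ → ℂ} {s : Set ℝ} (hf : ContinuousOn f s)
    (h : ∀ x ∈ s, 0 < (f x).re) : ContinuousOn (fun x => (f x).arg) s := fun x hx =>
  (Complex.continuousAt_arg (Or.inl (h x hx))).comp_continuousWithinAt (hf x hx)

/-- The phase takes each of the N values (N-1)π/2 - iπ, 0 ≤ i < N. Since N ≡ k mod 2, all are ≡
(k-1)π/2 mod π, where the two summands cancel. The arc stops at t < π/2 because ±i lie outside the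
half plane Re z > 0. -/
lemma exists_finset_zeros_of_phase {k N : ℕ} {d : ℤ} (hN : (N : ℤ) = k + 2 * d) (hk : 1 ≤ k)
    {U : ℂ → ℂ} (hconj : ∀ z, U ((starRingEnd ℂ) z) = (starRingEnd ℂ) (U z))
    {ψ R : ℝ → ℝ} {t : ℝ} (ht0 : 0 < t) (ht : t < Real.pi / 2)
    (hψ : ContinuousOn ψ (Set.Icc (-t) t))
    (hU : ∀ θ ∈ Set.Icc (-t) t, U (Complex.exp (θ * Complex.I)) =
      R θ * Complex.exp (-(ψ θ * Complex.I)))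
    (hr : ((N : ℝ) - 1) * Real.pi / 2 ≤ (k - 1) * t + ψ t)
    (hl : (k - 1) * (-t) + ψ (-t) ≤ -(((N : ℝ) - 1) * Real.pi / 2)) :
    ∃ s : Finset ℂ, s.card = N ∧ ∀ z ∈ s, ‖z‖ = 1 ∧ 0 < z.re ∧
      z ^ (2 * k - 1) * U z⁻¹ + (-1) ^ k * z * U z = 0 := by
  have hpi := Real.pi_pos
  have hex : ∀ i : Fin N, ∃ θ ∈ Set.Icc (-t) t,
      ((k : ℝ) - 1) * θ + ψ θ = ((N : ℝ) - 1) * Real.pi / 2 - i * Real.pi := by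
    intro i
    have hc : ContinuousOn (fun θ => ((k : ℝ) - 1) * θ + ψ θ) (Set.Icc (-t) t) :=
      (by fun_prop : Continuous fun θ : ℝ => ((k : ℝ) - 1) * θ).continuousOn.add hψ
    have hi : ((i : ℕ) : ℝ) + 1 ≤ N := by exact_mod_cast i.2
    have hi0 : (0 : ℝ) ≤ ((i : ℕ) : ℝ) := Nat.cast_nonneg _
    exact intermediate_value_Icc (by linarith) hc ⟨by nlinarith, by nlinarith⟩
  choose Θ hΘ hval using hex
  refine ⟨Finset.univ.image fun i => Complex.exp (Θ i * Complex.I), ?_, ?_⟩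
  · rw [Finset.card_image_of_injective _ ?_, Finset.card_fin]
    intro i j hij
    have him := congrArg Complex.im hij
    simp only [Complex.exp_ofReal_mul_I_im] at him
    have hmem : ∀ i, Θ i ∈ Set.Icc (-(Real.pi / 2)) (Real.pi / 2) := fun i =>
      ⟨by linarith [(hΘ i).1], by linarith [(hΘ i).2]⟩
    have hΘij := Real.injOn_sin (hmem i) (hmem j) him
    have h1 := hval i
    rw [hΘij, hval j] at h1
    have h2 : ((i : ℕ) : ℝ) = (j : ℕ) := mul_right_cancel₀ hpi.ne' (by linarith)
    exact Fin.ext (by exact_mod_cast h2)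
  · intro z hz
    obtain ⟨i, -, rfl⟩ := Finset.mem_image.1 hz
    have hn : ‖Complex.exp (Θ i * Complex.I)‖ = 1 := Complex.norm_exp_ofReal_mul_I _
    refine ⟨hn, exp_mul_I_re_pos ht (hΘ i), ?_⟩
    rw [Complex.inv_eq_conj hn, hconj, hU _ (hΘ i), map_mul, Complex.conj_ofReal,
      ← Complex.exp_conj, map_neg, map_mul, Complex.conj_ofReal, Complex.conj_I]
    set z := Complex.exp (Θ i * Complex.I) with hzdef
    obtain ⟨l, rfl⟩ : ∃ l, k = l + 1 := ⟨k - 1, by omega⟩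
    have hv : (l : ℂ) * Θ i + ψ (Θ i) = l * Real.pi / 2 + ((d - (i : ℕ) : ℤ) : ℂ) * Real.pi := by
      have h1 := hval i
      have h2 : (N : ℝ) = l + 1 + 2 * d := by exact_mod_cast hN
      rw [h2] at h1
      have : (l : ℝ) * Θ i + ψ (Θ i) = l * Real.pi / 2 + ((d - (i : ℕ) : ℤ) : ℝ) * Real.pi := by
        push_cast at h1 ⊢
        linarith
      exact_mod_cast this
    have key : z ^ (2 * l) * Complex.exp (ψ (Θ i) * Complex.I) =
        (-1) ^ l * Complex.exp (-(ψ (Θ i) * Complex.I)) := by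
      have h1 : z ^ (2 * l) * Complex.exp (ψ (Θ i) * Complex.I) =
          Complex.exp (2 * (l * Θ i + ψ (Θ i)) * Complex.I) *
            Complex.exp (-(ψ (Θ i) * Complex.I)) := by
        rw [hzdef, ← Complex.exp_nat_mul, ← Complex.exp_add, ← Complex.exp_add]
        congr 1
        push_cast
        ring
      rw [h1, hv, show 2 * (l * Real.pi / 2 + ((d - (i : ℕ) : ℤ) : ℂ) * Real.pi) * Complex.I =
        l * (Real.pi * Complex.I) + ((d - (i : ℕ) : ℤ) : ℂ) * (2 * Real.pi * Complex.I) by ring,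
        Complex.exp_add, Complex.exp_int_mul_two_pi_mul_I, mul_one, Complex.exp_nat_mul,
        Complex.exp_pi_mul_I]
    rw [show 2 * (l + 1) - 1 = 2 * l + 1 by omega,
      show -((ψ (Θ i) : ℂ) * -Complex.I) = ψ (Θ i) * Complex.I by ring]
    linear_combination z * R (Θ i) * key

/-! ### Zeros on the right and left half circles. -/

lemma hasSum_riemannZeta_two_mul_sub_one {k : ℕ} (hk : 2 ≤ k) :
    HasSum (fun n : ℕ => 1 / ((n : ℂ) + 1) ^ (2 * k - 1)) (riemannZeta (2 * (k : ℂ) - 1)) := by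
  have h := hasSum_riemannZeta_nat (s := 2 * k - 1) (by omega)
  rwa [show ((2 * k - 1 : ℕ) : ℂ) = 2 * (k : ℂ) - 1 by
    rw [Nat.cast_sub (by omega)]; push_cast; ring] at h

lemma conj_riemannZeta_two_mul_sub_one {k : ℕ} (hk : 2 ≤ k) :
    (starRingEnd ℂ) (riemannZeta (2 * (k : ℂ) - 1)) = riemannZeta (2 * (k : ℂ) - 1) := by
  rw [← (hasSum_riemannZeta_two_mul_sub_one hk).tsum_eq, Complex.conj_tsum]
  simp

/-- The expression equals 2 / (1 - 1/q), and 1 - 1/q has positive real part when |q| > 1. -/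
lemma two_add_two_div_sub_one_re_pos {q : ℂ} (hq : 1 < ‖q‖) : 0 < (2 + 2 / (q - 1)).re := by
  have h0 : q - 1 ≠ 0 := by
    intro h
    rw [sub_eq_zero.1 h, norm_one] at hq
    exact lt_irrefl _ hq
  have h1 : 0 < Complex.normSq (q - 1) := Complex.normSq_pos.2 h0
  have h2 : Complex.normSq (q - 1) = ‖q‖ ^ 2 - 2 * q.re + 1 := by
    rw [← Complex.normSq_eq_norm_sq]
    simp [Complex.normSq_apply]
    ring
  have h3 := Complex.re_le_norm q
  have h4 : (2 + 2 / (q - 1)).re =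
      2 * (Complex.normSq (q - 1) + (q.re - 1)) / Complex.normSq (q - 1) := by
    rw [Complex.add_re, Complex.div_re]
    simp
    field_simp
  rw [h4]
  apply div_pos _ h1
  rw [h2]
  nlinarith

lemma two_zeta_add_lambertCoth_re_pos {k : ℕ} (hk : 2 ≤ k) {z : ℂ} (hz : 0 < z.re) :
    0 < (2 * riemannZeta (2 * (k : ℂ) - 1) + lambertCoth k z).re := by
  have h := Complex.hasSum_re
    (((hasSum_riemannZeta_two_mul_sub_one hk).mul_left 2).add (summable_lambertCoth hk hz).hasSum)
  have hpos : ∀ n : ℕ, 0 < (2 * (1 / ((n : ℂ) + 1) ^ (2 * k - 1)) +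
      1 / ((n : ℂ) + 1) ^ (2 * k - 1) *
        (2 / (Complex.exp (2 * Real.pi * (((n : ℂ) + 1) * z)) - 1))).re := by
    intro n
    rw [show 2 * (1 / ((n : ℂ) + 1) ^ (2 * k - 1)) + 1 / ((n : ℂ) + 1) ^ (2 * k - 1) *
        (2 / (Complex.exp (2 * Real.pi * (((n : ℂ) + 1) * z)) - 1)) =
        ((1 / ((n : ℝ) + 1) ^ (2 * k - 1) : ℝ) : ℂ) *
          (2 + 2 / (Complex.exp (2 * Real.pi * (((n : ℂ) + 1) * z)) - 1)) by push_cast; ring,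
      Complex.re_ofReal_mul]
    refine mul_pos (by positivity) (two_add_two_div_sub_one_re_pos ?_)
    rw [Complex.norm_exp, Real.one_lt_exp_iff]
    exact two_pi_mul_re_pos (re_natCast_add_one_mul_pos n hz)
  exact (hpos 0).trans_le (le_hasSum h 0 fun n _ => (hpos n).le)

lemma one_sub_exp_neg_re_pos {w : ℂ} (hw : 0 < w.re) : 0 < (1 - Complex.exp (-w)).re := by
  have h1 := Complex.re_le_norm (Complex.exp (-w))
  rw [Complex.norm_exp] at h1
  have h2 : Real.exp (-w).re < 1 := by
    rw [Real.exp_lt_one_iff]; simpa using hw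
  rw [Complex.sub_re, Complex.one_re]
  linarith

lemma exists_finset_right_zeros {k : ℕ} (hk : 2 ≤ k) :
    ∃ s : Finset ℂ, s.card = k + 2 ∧ ∀ z ∈ s, ‖z‖ = 1 ∧ 0 < z.re ∧
      (ramanujanP k).IsRoot z := by
  have hpi := Real.pi_pos
  -- The allowance π/3 is what remains: 2π - π/3 - π/2 (arg W) - π/6 (arg V) = π, and (k-1)π/2 + π =
  -- (k+1)π/2 is the end value required for k + 2 zeros.
  obtain ⟨t, ht, ht0, hg⟩ : ∃ t : ℝ, t < Real.pi / 2 ∧ 0 < t ∧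
      ((k : ℝ) - 1) * (Real.pi / 2) + 2 * Real.pi * Real.sin (Real.pi / 2) - Real.pi / 3 <
        (k - 1) * t + 2 * Real.pi * Real.sin t := by
    have hc : Continuous fun t : ℝ => ((k : ℝ) - 1) * t + 2 * Real.pi * Real.sin t := by fun_prop
    have h1 := (hc.tendsto (Real.pi / 2)).eventually (lt_mem_nhds (sub_lt_self
      (((k : ℝ) - 1) * (Real.pi / 2) + 2 * Real.pi * Real.sin (Real.pi / 2))
        (by positivity : 0 < Real.pi / 3)))
    have h2 := lt_mem_nhds (by positivity : 0 < Real.pi / 2)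
    obtain ⟨t, ⟨ha, hb⟩, hlt⟩ := (((h1.and h2).filter_mono nhdsWithin_le_nhds).and
      (self_mem_nhdsWithin (s := Set.Iio (Real.pi / 2)))).exists
    exact ⟨t, hlt, hb, ha⟩
  rw [Real.sin_pi_div_two] at hg
  set z : ℝ → ℂ := fun θ => Complex.exp (θ * Complex.I) with hz
  set V : ℝ → ℂ := fun θ =>
    lambertCoth k (z θ) * ((Complex.exp (2 * Real.pi * z θ) - 1) / 2) with hV
  -- With q = e^(2πz) one has L = 2V / (qW). The argument 2π sin θ of q is kept unreduced, while V
  -- and W have positive real part and so continuous principal arguments.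
  set W : ℝ → ℂ := fun θ => 1 - Complex.exp (-(2 * Real.pi * z θ)) with hW
  have hzre : ∀ θ ∈ Set.Icc (-t) t, 0 < (z θ).re := fun θ hθ => exp_mul_I_re_pos ht hθ
  have hVle : ∀ θ ∈ Set.Icc (-t) t, ‖V θ - 1‖ ≤ 1 / 5 := fun θ hθ =>
    norm_lambertCoth_mul_sub_one_le hk (hzre θ hθ) (Complex.norm_exp_ofReal_mul_I θ)
  have hWre : ∀ θ ∈ Set.Icc (-t) t, 0 < (W θ).re := fun θ hθ =>
    one_sub_exp_neg_re_pos (two_pi_mul_re_pos (hzre θ hθ))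
  have hVarg : ∀ θ ∈ Set.Icc (-t) t, |(V θ).arg| ≤ Real.pi / 6 := fun θ hθ =>
    abs_arg_le_of_norm_sub_one_le (hVle θ hθ)
  have hWarg : ∀ θ ∈ Set.Icc (-t) t, |(W θ).arg| ≤ Real.pi / 2 := fun θ hθ =>
    Complex.abs_arg_le_pi_div_two_iff.2 (hWre θ hθ).le
  have hright : t ∈ Set.Icc (-t) t := ⟨by linarith, le_rfl⟩
  have hleft : -t ∈ Set.Icc (-t) t := ⟨le_rfl, by linarith⟩
  refine (exists_finset_zeros_of_phase (k := k) (N := k + 2) (d := 1)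
    (by push_cast; ring) (by omega) (lambertCoth_conj k)
    (ψ := fun θ => 2 * Real.pi * Real.sin θ + (W θ).arg - (V θ).arg)
    (R := fun θ => 2 * ‖V θ‖ / (Real.exp (2 * Real.pi * Real.cos θ) * ‖W θ‖)) ht0 ht
    ?_ ?_ ?_ ?_).imp fun s hs => ⟨hs.1, fun w hw =>
      ⟨(hs.2 w hw).1, (hs.2 w hw).2.1, by
        rw [IsRoot.def, eval_ramanujanP_eq_lambertCoth hk (hs.2 w hw).2.1 (hs.2 w hw).1,
          (hs.2 w hw).2.2, neg_zero]⟩⟩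
  · refine ContinuousOn.sub (ContinuousOn.add (by fun_prop)
      (ContinuousOn.complex_arg (by fun_prop) hWre)) (ContinuousOn.complex_arg ?_ fun θ hθ => ?_)
    · exact (continuousOn_lambertCoth_circle hk ht0 ht).mul (by fun_prop)
    · linarith [re_pos_of_norm_sub_one_le (hVle θ hθ)]
  · intro θ hθ
    have hW0 : W θ ≠ 0 := fun h0 => by simpa [h0] using hWre θ hθ
    have hq1 := exp_sub_one_ne_zero_of_re_pos (two_pi_mul_re_pos (hzre θ hθ))
    have hq : Complex.exp (2 * Real.pi * z θ) = Real.exp (2 * Real.pi * Real.cos θ) *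
        Complex.exp (2 * Real.pi * Real.sin θ * Complex.I) := by
      rw [Complex.ofReal_exp, ← Complex.exp_add, hz]
      dsimp only
      rw [Complex.exp_mul_I]
      push_cast
      ring_nf
    have hqW : Complex.exp (2 * Real.pi * z θ) - 1 = Complex.exp (2 * Real.pi * z θ) * W θ := by
      rw [hW]
      dsimp only
      rw [mul_sub, ← Complex.exp_add]
      simp
    have hT : lambertCoth k (z θ) = 2 * V θ / (Complex.exp (2 * Real.pi * z θ) * W θ) := by
      rw [← hqW, hV]
      field_simp
    have e1 := Complex.norm_mul_exp_arg_mul_I (V θ)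
    have e2 := Complex.norm_mul_exp_arg_mul_I (W θ)
    have hWn : (‖W θ‖ : ℂ) ≠ 0 := by exact_mod_cast norm_ne_zero_iff.2 hW0
    change lambertCoth k (z θ) = _
    rw [hT]
    conv_lhs => rw [← e1, ← e2]
    rw [hq]
    have he : Complex.exp (-(((2 * Real.pi * Real.sin θ + (W θ).arg - (V θ).arg : ℝ) : ℂ) *
        Complex.I)) = Complex.exp ((V θ).arg * Complex.I) /
          (Complex.exp (2 * Real.pi * Real.sin θ * Complex.I) *
            Complex.exp ((W θ).arg * Complex.I)) := by
      rw [← Complex.exp_add, ← Complex.exp_sub]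
      push_cast
      ring_nf
    rw [he]
    push_cast
    field_simp
  · have h1 := abs_le.1 (hVarg t hright)
    have h2 := abs_le.1 (hWarg t hright)
    push_cast
    linarith [h1.2, h2.1]
  · have h1 := abs_le.1 (hVarg (-t) hleft)
    have h2 := abs_le.1 (hWarg (-t) hleft)
    rw [Real.sin_neg]
    push_cast
    linarith [h1.1, h2.2]

lemma exists_finset_left_zeros {k : ℕ} (hk : 2 ≤ k) :
    ∃ s : Finset ℂ, s.card = k - 2 ∧ ∀ z ∈ s, ‖z‖ = 1 ∧ 0 < z.re ∧
      (ramanujanP k).IsRoot (-z) := by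
  have hpi := Real.pi_pos
  have hk1 : (0 : ℝ) < k - 1 := by
    have : (2 : ℝ) ≤ k := by exact_mod_cast hk
    linarith
  obtain ⟨t, ht, ht0, hg⟩ : ∃ t : ℝ, t < Real.pi / 2 ∧ 0 < t ∧
      ((k : ℝ) - 1) * (Real.pi / 2) - Real.pi / 2 ≤ (k - 1) * t := by
    -- Stopping short by π/(2(k+1)) costs the phase (k-1)θ at most π/2; another π/2 goes to arg U,
    -- leaving the (k-3)π/2 needed for k - 2 zeros.
    refine ⟨Real.pi / 2 - Real.pi / 2 / (k + 1), ?_, ?_, ?_⟩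
    · have : 0 < Real.pi / 2 / (k + 1) := by positivity
      linarith
    · have : Real.pi / 2 / (k + 1) < Real.pi / 2 := div_lt_self (by positivity) (by linarith)
      linarith
    · rw [mul_sub]
      have : ((k : ℝ) - 1) * (Real.pi / 2 / (k + 1)) ≤ Real.pi / 2 := by
        rw [← mul_div_assoc, div_le_iff₀ (by linarith)]
        nlinarith
      linarith
  set U : ℂ → ℂ := fun z => 2 * riemannZeta (2 * (k : ℂ) - 1) + lambertCoth k z with hU
  have hre : ∀ θ ∈ Set.Icc (-t) t, 0 < (U (Complex.exp (θ * Complex.I))).re := fun θ hθ =>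
    two_zeta_add_lambertCoth_re_pos hk (exp_mul_I_re_pos ht hθ)
  have harg : ∀ θ ∈ Set.Icc (-t) t, |(U (Complex.exp (θ * Complex.I))).arg| ≤ Real.pi / 2 :=
    fun θ hθ => Complex.abs_arg_le_pi_div_two_iff.2 (hre θ hθ).le
  have hkc : ((k - 2 : ℕ) : ℝ) = k - 2 := by push_cast [hk]; ring
  refine (exists_finset_zeros_of_phase (k := k) (N := k - 2) (d := -1)
    (by push_cast [hk]; ring) (by omega) (U := U)
    (fun z => by
      simp only [hU, map_add, map_mul, map_ofNat, lambertCoth_conj,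
        conj_riemannZeta_two_mul_sub_one hk])
    (ψ := fun θ => -(U (Complex.exp (θ * Complex.I))).arg)
    (R := fun θ => ‖U (Complex.exp (θ * Complex.I))‖) ht0 ht
    ?_ ?_ ?_ ?_).imp fun s hs => ⟨hs.1, fun w hw =>
      ⟨(hs.2 w hw).1, (hs.2 w hw).2.1, by
        rw [IsRoot.def, eval_neg_ramanujanP_eq_lambertCoth hk (hs.2 w hw).2.1 (hs.2 w hw).1,
          (hs.2 w hw).2.2, neg_zero]⟩⟩
  · exact (ContinuousOn.complex_arg
      (continuousOn_const.add (continuousOn_lambertCoth_circle hk ht0 ht)) hre).neg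
  · intro θ _
    have := Complex.norm_mul_exp_arg_mul_I (U (Complex.exp (θ * Complex.I)))
    rw [Complex.ofReal_neg, neg_mul, neg_neg, this]
  · have := (abs_le.1 (harg t ⟨by linarith, le_rfl⟩)).2
    rw [hkc]
    linarith
  · have := (abs_le.1 (harg (-t) ⟨le_rfl, by linarith⟩)).1
    rw [hkc]
    linarith

/-! ### Counting against the degree. -/

lemma natDegree_ramanujanP_le {k : ℕ} (hk : 2 ≤ k) : (ramanujanP k).natDegree ≤ 2 * k := by
  rw [ramanujanP]
  refine natDegree_add_le_of_degree_le ((natDegree_C_mul_le _ _).trans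
    (natDegree_sum_le_of_forall_le _ _ fun j hj => ?_)) ((natDegree_C_mul_le _ _).trans
      (natDegree_add_le_of_degree_le ?_ ?_))
  · exact (natDegree_C_mul_X_pow_le _ _).trans (by have := Finset.mem_range.1 hj; omega)
  · exact (natDegree_X_pow_le _).trans (by omega)
  · exact (natDegree_C_mul_le _ _).trans (natDegree_X_le.trans (by omega))

/-- The value at 0 is a nonzero multiple of ζ(0)ζ(2k), and ζ has no zeros in Re s ≥ 1. -/
lemma ramanujanP_ne_zero {k : ℕ} (hk : 2 ≤ k) : ramanujanP k ≠ 0 := by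
  intro h
  have h0 := eval_ramanujanP (k := k) (by omega) 0
  rw [h, eval_zero, Finset.sum_eq_single_of_mem 0 (by simp)
    (fun j _ hj => by rw [zero_pow (by omega), mul_zero])] at h0
  have hz : riemannZeta (2 * (k : ℂ)) ≠ 0 := riemannZeta_ne_zero_of_one_le_re (by
    have : (2 : ℝ) ≤ k := by exact_mod_cast hk
    simp
    linarith)
  have hpi : (Real.pi : ℂ) ≠ 0 := by exact_mod_cast Real.pi_ne_zero
  rw [zero_pow (by omega : 2 * k - 1 ≠ 0)] at h0
  simp [riemannZeta_zero, hz, hpi] at h0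

lemma norm_eq_one_and_rootMultiplicity_eq_one_of_card {P : ℂ[X]} (hP : P ≠ 0) {s : Finset ℂ}
    (hs : P.natDegree ≤ s.card) (h : ∀ z ∈ s, ‖z‖ = 1 ∧ P.IsRoot z) {z : ℂ} (hz : P.IsRoot z) :
    ‖z‖ = 1 ∧ P.rootMultiplicity z = 1 := by
  have hle : s.val ≤ P.roots :=
    (Multiset.le_iff_subset s.nodup).2 fun w hw => (mem_roots hP).2 (h w hw).2
  have heq : s.val = P.roots := Multiset.eq_of_le_of_card_le hle ((card_roots' P).trans hs)
  have hmem : z ∈ s.val := heq ▸ (mem_roots hP).2 hz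
  refine ⟨(h z hmem).1, ?_⟩
  rw [← count_roots, ← heq]
  exact Multiset.count_eq_one_of_mem s.nodup hmem

theorem theorem5 (k : ℕ) (hk : 2 ≤ k) (hk' : k < 1000) :
    ∀ z : ℂ, (ramanujanP k).IsRoot z →
      ‖z‖ = 1 ∧ (ramanujanP k).rootMultiplicity z = 1 := by
  intro z hz
  obtain ⟨r, hr, hr'⟩ := exists_finset_right_zeros hk
  obtain ⟨l, hl, hl'⟩ := exists_finset_left_zeros hk
  have hdisj : Disjoint r (l.image Neg.neg) := by
    rw [Finset.disjoint_left]
    intro w hw hw'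
    obtain ⟨v, hv, rfl⟩ := Finset.mem_image.1 hw'
    have h1 := (hr' _ hw).2.1
    rw [Complex.neg_re] at h1
    linarith [(hl' v hv).2.1]
  refine norm_eq_one_and_rootMultiplicity_eq_one_of_card (ramanujanP_ne_zero hk)
    (s := r ∪ l.image Neg.neg) ?_ (fun w hw => ?_) hz
  · rw [Finset.card_union_of_disjoint hdisj, Finset.card_image_of_injective _ neg_injective, hr, hl]
    exact (natDegree_ramanujanP_le hk).trans (by omega)
  · rcases Finset.mem_union.1 hw with hw | hw
    · exact ⟨(hr' w hw).1, (hr' w hw).2.2⟩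
    · obtain ⟨v, hv, rfl⟩ := Finset.mem_image.1 hw
      exact ⟨by rw [norm_neg]; exact (hl' v hv).1, (hl' v hv).2.2⟩
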